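/- Conventions. Let $\mathbb{K}=\mathbb{R}$ or $\mathbb{C}$ and let $E,F$ be Banach spaces over $\mathbb{K}$, with $E'$ the dual of $E$. For a positive integer $n$, $\mathcal{P}(^{n}E;F)$ denotes the space of continuous $n$-homogeneous polynomials from $E$ to $F$, that is, mappings of the form $x\mapsto A(x,\dots,x)$ with $A\colon E^n\to F$ continuous and $n$-linear; $\mathcal{P}(^{n}E):=\mathcal{P}(^{n}E;\mathbb{K})$. A sequence $(x_j)_{j\ge 1}$ in $E$ is unconditionally $1$-summable if $\sum_j|\varphi(x_j)|<\infty$ for every $\varphi\in E'$ and $$\lim_{k\to\infty}\ \sup\Big\{\sum_{j\ge k}|\varphi(x_j)| : \varphi\in E',\ \|\varphi\|\le 1\Big\}=0 .$$ For a mapping $f\colon E\to F$, the $1$-summing set $S_1(f)$ is the set of all $a\in E$ such that $\sum_{j}\|f(a+x_j)-f(a)\|<\infty$ for every unconditionally $1$-summable sequence $(x_j)$ in $E$. A set $A\subseteq E$ is spaceable if $A\cup\{0\}$ contains a closed infinite-dimensional linear subspace of $E$. For $P\colon E\to\mathbb{K}$ and $g\colon E\to F$, $P\cdot g$ is the mapping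 $x\mapsto P(x)g(x)$. Corollary. (a) (Complex case) Let $E$ and $F$ be complex Banach spaces with $E$ infinite-dimensional, let $n\ge 1$, let $P\in\mathcal{P}(^{n}E)$ and let $g\colon E\to F$ be continuous. Then $S_1(P\cdot g)$ is spaceable. (b) (Real case) Let $E$ and $F$ be real Banach spaces with $E$ infinite-dimensional. At least one of the following holds: (b1) there exists $P\in\mathcal{P}(^{3}E;E)$ such that $S_1(P)=\{0\}$; (b2) for every $P\in\mathcal{P}(^{2}E)$ and every continuous mapping $g\colon E\to F$, the set $S_1(P\cdot g)$ is spaceable. -/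

import Mathlib

open Filter Topology
open scoped ENNReal NNReal

namespace SummingSets

section

variable (𝕜 : Type*) [RCLike 𝕜]
variable {E : Type*} [NormedAddCommGroup E] [NormedSpace 𝕜 E]
variable {F : Type*} [NormedAddCommGroup F] [NormedSpace 𝕜 F]

/-- `P` is a continuous `n`-homogeneous polynomial from `E` to `F`: it is the restriction to the
diagonal of a continuous `n`-linear mapping. (By polarization this is the same as asking for a
symmetric such mapping, or for `P` itself to be continuous.) -/
def IsHomogeneousPolynomial (n : ℕ) (P : E → F) : Prop :=
  ∃ A : ContinuousMultilinearMap 𝕜 (fun _ : Fin n => E) F, ∀ x : E, P x = A (fun _ => x)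

/-- The weak `q`-norm `sup {(∑ⱼ |φ(xⱼ)|^q)^(1/q) : φ ∈ E', ‖φ‖ ≤ 1}` of a sequence, with values in
`[0, ∞]`. -/
noncomputable def weakNorm (q : ℝ≥0) (x : ℕ → E) : ℝ≥0∞ :=
  ⨆ (φ : StrongDual 𝕜 E) (_ : ‖φ‖ ≤ 1), (∑' j, ‖φ (x j)‖ₑ ^ (q : ℝ)) ^ (1 / (q : ℝ))

/-- The space `ℓ_q^w(E)`: `(φ(xⱼ))ⱼ ∈ ℓ_q` for every `φ ∈ E'`. -/
def WeaklySummable (q : ℝ≥0) (x : ℕ → E) : Prop :=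
  ∀ φ : StrongDual 𝕜 E, Memℓp (fun j => φ (x j)) (q : ℝ≥0∞)

/-- The space `ℓ_q^u(E)` of unconditionally `q`-summable sequences: those in `ℓ_q^w(E)` whose tails
tend to zero in the weak `q`-norm. -/
def UnconditionallySummable (q : ℝ≥0) (x : ℕ → E) : Prop :=
  WeaklySummable 𝕜 q x ∧ Tendsto (fun k : ℕ => weakNorm 𝕜 q (fun j => x (k + j))) atTop (𝓝 0)

/-- `f` is `(p; q)`-summing at `a`: `(f(a + xⱼ) - f(a))ⱼ ∈ ℓ_p(F)` whenever `(xⱼ)ⱼ ∈ ℓ_q^u(E)`. -/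
def IsSummingAt (p q : ℝ≥0) (f : E → F) (a : E) : Prop :=
  ∀ x : ℕ → E, UnconditionallySummable 𝕜 q x →
    Memℓp (fun j => f (a + x j) - f a) (p : ℝ≥0∞)

/-- The `(p; q)`-summing set `S_{p;q}(f)`. -/
def summingSet (p q : ℝ≥0) (f : E → F) : Set E :=
  {a : E | IsSummingAt 𝕜 p q f a}

/-- The `1`-summing set `S₁(f) = S_{1;1}(f)`. -/
def summingSetOne (f : E → F) : Set E :=
  summingSet 𝕜 1 1 f

/-- `A` is spaceable: `A ∪ {0}` contains a closed infinite-dimensional linear subspace. -/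
def Spaceable (A : Set E) : Prop :=
  ∃ G : Submodule 𝕜 E, IsClosed (G : Set E) ∧ ¬ FiniteDimensional 𝕜 G ∧ (G : Set E) ⊆ A ∪ {0}

end

end SummingSets

/-!
For a scalar homogeneous polynomial `P` and a continuous `g`, every zero `a` of `P` lies in
`S₁(P · g)`: the sums `∑ ‖P (a + x_j)‖` are finite, by a random-sign polarization of the
multilinear form along a weakly summable sequence, and `g` is bounded along `a + x_j → a`. Hence
`S₁(P · g)` is spaceable as soon as `P` vanishes on an infinite-dimensional subspace. Over `ℂ` such
a subspace always exists: it is built vector by vector, each new vector being a root of a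
one-variable polynomial.

Over `ℝ` the obstruction is definiteness. If no continuous bilinear form on `E` is positive
definite, a maximal finite-dimensional isotropic subspace of `P` would have an anisotropic
complement of finite codimension, giving such a form, so `P` has an infinite-dimensional isotropic
subspace. If `Q` is a positive definite form, the cubic `x ↦ Q x x • x` works for (b1): being
summing at some `a ≠ 0` would force every unconditionally summable sequence to be absolutely
summable, against the Dvoretzky–Rogers theorem.

That theorem is obtained from a map `u : ℓ₂ᴺ → E` of norm at most one and maximal determinant:
if `u` were small on a subspace of more than half the dimension, stretching that subspace and
shrinking its orthogonal complement would increase the determinant.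
-/

namespace SummingSets

section WeakNorm

variable {𝕜 : Type*} [RCLike 𝕜]
variable {E : Type*} [NormedAddCommGroup E] [NormedSpace 𝕜 E]
variable {F : Type*} [NormedAddCommGroup F] [NormedSpace 𝕜 F]
variable {G : Type*} [NormedAddCommGroup G] [NormedSpace 𝕜 G]

theorem memℓp_one_iff_summable_norm {x : ℕ → E} :
    Memℓp x ((1 : ℝ≥0) : ℝ≥0∞) ↔ Summable fun j => ‖x j‖ := by
  rw [memℓp_gen_iff (by simp)]
  simp

theorem summable_norm_iff_tsum_enorm_ne_top {x : ℕ → E} :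
    (Summable fun j => ‖x j‖) ↔ ∑' j, ‖x j‖ₑ ≠ ∞ := by
  simp only [enorm_eq_nnnorm, ENNReal.tsum_coe_ne_top_iff_summable, ← NNReal.summable_coe,
    coe_nnnorm]

theorem weakNorm_one_eq_iSup (x : ℕ → E) :
    weakNorm 𝕜 1 x = ⨆ (φ : StrongDual 𝕜 E) (_ : ‖φ‖ ≤ 1), ∑' j, ‖φ (x j)‖ₑ := by
  simp [weakNorm]

theorem tsum_enorm_le_weakNorm_one (x : ℕ → E) {φ : StrongDual 𝕜 E} (hφ : ‖φ‖ ≤ 1) :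
    ∑' j, ‖φ (x j)‖ₑ ≤ weakNorm 𝕜 1 x := by
  rw [weakNorm_one_eq_iSup]
  exact le_iSup₂ (f := fun (φ : StrongDual 𝕜 E) (_ : ‖φ‖ ≤ 1) => ∑' j, ‖φ (x j)‖ₑ) φ hφ

theorem enorm_sum_smul_le_weakNorm_one (x : ℕ → E) (S : Finset ℕ) {c : ℕ → 𝕜}
    (hc : ∀ j, ‖c j‖ ≤ 1) : ‖∑ j ∈ S, c j • x j‖ₑ ≤ weakNorm 𝕜 1 x := by
  obtain ⟨φ, hφ, hφ_attains⟩ := exists_dual_vector'' 𝕜 (∑ j ∈ S, c j • x j)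
  calc ‖∑ j ∈ S, c j • x j‖ₑ = ‖∑ j ∈ S, c j * φ (x j)‖ₑ := by
        simp only [← smul_eq_mul, ← map_smul, ← map_sum, hφ_attains, ← ofReal_norm,
          RCLike.norm_ofReal, abs_norm]
    _ ≤ ∑ j ∈ S, ‖c j * φ (x j)‖ₑ := enorm_sum_le _ _
    _ ≤ ∑ j ∈ S, ‖φ (x j)‖ₑ := Finset.sum_le_sum fun j _ => by
        rw [enorm_mul]
        exact mul_le_of_le_one_left' (by simpa [← ofReal_norm] using hc j)
    _ ≤ ∑' j, ‖φ (x j)‖ₑ := ENNReal.sum_le_tsum _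
    _ ≤ weakNorm 𝕜 1 x := tsum_enorm_le_weakNorm_one x hφ

theorem weakNorm_one_le_iff {x : ℕ → E} {C : ℝ≥0∞} :
    weakNorm 𝕜 1 x ≤ C ↔
      ∀ (S : Finset ℕ) (c : ℕ → 𝕜), (∀ j, ‖c j‖ ≤ 1) → ‖∑ j ∈ S, c j • x j‖ₑ ≤ C := by
  refine ⟨fun h S c hc => (enorm_sum_smul_le_weakNorm_one x S hc).trans h, fun h => ?_⟩
  rw [weakNorm_one_eq_iSup]
  refine iSup₂_le fun φ hφ => ENNReal.summable.tsum_le_of_sum_le fun S => ?_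
  choose c hc hcφ using fun j => RCLike.exists_norm_eq_mul_self (φ (x j))
  have hsum : ((∑ j ∈ S, ‖φ (x j)‖ : ℝ) : 𝕜) = φ (∑ j ∈ S, c j • x j) := by
    simp only [hcφ, map_sum, map_smul, smul_eq_mul]
  calc ∑ j ∈ S, ‖φ (x j)‖ₑ = ENNReal.ofReal (∑ j ∈ S, ‖φ (x j)‖) := by
        rw [ENNReal.ofReal_sum_of_nonneg fun _ _ => norm_nonneg _]
        simp only [ofReal_norm]
    _ ≤ ENNReal.ofReal ‖φ (∑ j ∈ S, c j • x j)‖ := by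
        rw [← hsum, RCLike.norm_ofReal]
        exact ENNReal.ofReal_le_ofReal (le_abs_self _)
    _ ≤ ‖∑ j ∈ S, c j • x j‖ₑ := by
        rw [← ofReal_norm (∑ j ∈ S, c j • x j)]
        exact ENNReal.ofReal_le_ofReal (by simpa only [one_mul] using φ.le_of_opNorm_le hφ _)
    _ ≤ C := h S c fun j => (hc j).le

theorem weakNorm_one_add_le (x y : ℕ → E) :
    weakNorm 𝕜 1 (fun j => x j + y j) ≤ weakNorm 𝕜 1 x + weakNorm 𝕜 1 y := by
  refine weakNorm_one_le_iff.2 fun S c hc => ?_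
  simp only [smul_add, Finset.sum_add_distrib]
  exact (enorm_add_le _ _).trans (add_le_add (enorm_sum_smul_le_weakNorm_one x S hc)
    (enorm_sum_smul_le_weakNorm_one y S hc))

theorem weakNorm_one_map_le (T : E →L[𝕜] F) (x : ℕ → E) :
    weakNorm 𝕜 1 (fun j => T (x j)) ≤ ‖T‖ₑ * weakNorm 𝕜 1 x := by
  refine weakNorm_one_le_iff.2 fun S c hc => ?_
  have hsum : ∑ j ∈ S, c j • T (x j) = T (∑ j ∈ S, c j • x j) := by simp
  rw [hsum]
  exact (T.le_opENorm _).trans (by gcongr; exact enorm_sum_smul_le_weakNorm_one x S hc)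

theorem weakNorm_one_map_ne_top (T : E →L[𝕜] F) {x : ℕ → E} (hx : weakNorm 𝕜 1 x ≠ ∞) :
    weakNorm 𝕜 1 (fun j => T (x j)) ≠ ∞ :=
  ne_top_of_le_ne_top (ENNReal.mul_ne_top enorm_ne_top hx) (weakNorm_one_map_le T x)

theorem tsum_enorm_le_weakNorm_one_self (x : ℕ → 𝕜) : ∑' j, ‖x j‖ₑ ≤ weakNorm 𝕜 1 x :=
  tsum_enorm_le_weakNorm_one x (φ := .id 𝕜 𝕜) ContinuousLinearMap.norm_id_le

theorem exists_eq_one_or_neg_one_norm_le_norm_add_smul (v w : E) :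
    ∃ s : 𝕜, (s = 1 ∨ s = -1) ∧ ‖v‖ ≤ ‖v + s • w‖ := by
  by_contra! hlt
  have hplus : ‖v + w‖ < ‖v‖ := by simpa using hlt 1 (.inl rfl)
  have hminus : ‖v - w‖ < ‖v‖ := by simpa [sub_eq_add_neg] using hlt (-1) (.inr rfl)
  have htwo : 2 * ‖v‖ ≤ ‖v + w‖ + ‖v - w‖ :=
    calc 2 * ‖v‖ = ‖(v + w) + (v - w)‖ := by
          rw [add_add_sub_cancel, ← two_smul 𝕜, norm_smul, RCLike.norm_two]
      _ ≤ ‖v + w‖ + ‖v - w‖ := norm_add_le _ _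
  linarith

/- Averaging over independent random signs `ε` shows that `∑ⱼ B (xⱼ) (yⱼ)` is the mean of
`B (∑ᵢ εᵢ xᵢ) (∑ⱼ εⱼ yⱼ)`; choosing the signs one at a time realises a value at least as large. -/
theorem exists_sign_norm_add_sum_le (B : E →ₗ[𝕜] F →ₗ[𝕜] G) (x : ℕ → E) (y : ℕ → F)
    (S : Finset ℕ) (b : G) :
    ∃ ε : ℕ → 𝕜, (∀ j, ε j = 1 ∨ ε j = -1) ∧
      ‖b + ∑ j ∈ S, B (x j) (y j)‖ ≤
        ‖b + B (∑ j ∈ S, ε j • x j) (∑ j ∈ S, ε j • y j)‖ := by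
  induction S using Finset.induction_on generalizing b with
  | empty => exact ⟨fun _ => 1, fun _ => .inl rfl, by simp⟩
  | insert k S hk ih =>
    obtain ⟨ε, hε, hle⟩ := ih (b + B (x k) (y k))
    set u := ∑ j ∈ S, ε j • x j with hu
    set v := ∑ j ∈ S, ε j • y j with hv
    obtain ⟨s, hs, hsign⟩ := exists_eq_one_or_neg_one_norm_le_norm_add_smul (𝕜 := 𝕜)
      (b + B (x k) (y k) + B u v) (B u (y k) + B (x k) v)
    have hs_sq : s * s = 1 := by rcases hs with rfl | rfl <;> simp
    have hne : ∀ j ∈ S, j ≠ k := fun j hj h => hk (h ▸ hj)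
    have hx : ∑ j ∈ insert k S, Function.update ε k s j • x j = s • x k + u := by
      rw [Finset.sum_insert hk, Function.update_self, hu]
      exact congrArg _ (Finset.sum_congr rfl fun j hj => by
        rw [Function.update_of_ne (hne j hj)])
    have hy : ∑ j ∈ insert k S, Function.update ε k s j • y j = s • y k + v := by
      rw [Finset.sum_insert hk, Function.update_self, hv]
      exact congrArg _ (Finset.sum_congr rfl fun j hj => by
        rw [Function.update_of_ne (hne j hj)])
    have hexpand : b + B (s • x k + u) (s • y k + v) =
        b + B (x k) (y k) + B u v + s • (B u (y k) + B (x k) v) := by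
      simp only [map_add, map_smul, LinearMap.add_apply, LinearMap.smul_apply, smul_add,
        smul_smul, hs_sq, one_smul]
      abel
    refine ⟨Function.update ε k s, fun j => ?_, ?_⟩
    · rcases eq_or_ne j k with rfl | hj
      · simpa using hs
      · simpa [Function.update_of_ne hj] using hε j
    · rw [hx, hy, hexpand, Finset.sum_insert hk, ← add_assoc]
      exact hle.trans hsign

theorem weakNorm_one_bilinear_le (B : E →L[𝕜] F →L[𝕜] G) (x : ℕ → E) (y : ℕ → F) :
    weakNorm 𝕜 1 (fun j => B (x j) (y j)) ≤ ‖B‖ₑ * weakNorm 𝕜 1 x * weakNorm 𝕜 1 y := by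
  refine weakNorm_one_le_iff.2 fun S c hc => ?_
  obtain ⟨ε, hε, hle⟩ :=
    exists_sign_norm_add_sum_le B.toLinearMap₁₂ x (fun j => c j • y j) S 0
  have hε_norm (j : ℕ) : ‖ε j‖ ≤ 1 := by rcases hε j with h | h <;> simp [h]
  have hεc_norm (j : ℕ) : ‖ε j * c j‖ ≤ 1 :=
    (norm_mul _ _).trans_le (mul_le_one₀ (hε_norm j) (norm_nonneg _) (hc j))
  calc ‖∑ j ∈ S, c j • B (x j) (y j)‖ₑ
      ≤ ‖B (∑ j ∈ S, ε j • x j) (∑ j ∈ S, (ε j * c j) • y j)‖ₑ :=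
        enorm_le_iff_norm_le.2 (by simpa [smul_smul] using hle)
    _ ≤ ‖B‖ₑ * ‖∑ j ∈ S, ε j • x j‖ₑ * ‖∑ j ∈ S, (ε j * c j) • y j‖ₑ := B.le_opENorm₂ _ _
    _ ≤ ‖B‖ₑ * weakNorm 𝕜 1 x * weakNorm 𝕜 1 y := by
        gcongr
        · exact enorm_sum_smul_le_weakNorm_one x S hε_norm
        · exact enorm_sum_smul_le_weakNorm_one y S hεc_norm

theorem weakNorm_one_bilinear_sub_ne_top (B : E →L[𝕜] F →L[𝕜] G) {x : ℕ → E} {y : ℕ → F}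
    {a : E} {b : F} (hx : weakNorm 𝕜 1 (fun j => x j - a) ≠ ∞)
    (hy : weakNorm 𝕜 1 (fun j => y j - b) ≠ ∞) :
    weakNorm 𝕜 1 (fun j => B (x j) (y j) - B a b) ≠ ∞ := by
  have hsplit : (fun j => B (x j) (y j) - B a b) = fun j =>
      B (x j - a) (y j - b) + (B.flip b (x j - a) + B a (y j - b)) := by
    funext j
    simp only [map_sub, sub_apply, ContinuousLinearMap.flip_apply]
    abel
  rw [hsplit]
  refine ne_top_of_le_ne_top (ENNReal.add_ne_top.2 ⟨?_, ENNReal.add_ne_top.2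
    ⟨weakNorm_one_map_ne_top (B.flip b) hx, weakNorm_one_map_ne_top (B a) hy⟩⟩)
    ((weakNorm_one_add_le _ _).trans (add_le_add_right (weakNorm_one_add_le _ _) _))
  exact ne_top_of_le_ne_top (ENNReal.mul_ne_top (ENNReal.mul_ne_top enorm_ne_top hx) hy)
    (weakNorm_one_bilinear_le B _ _)

theorem weakNorm_one_multilinear_diagonal_sub_ne_top {n : ℕ}
    {A : ℕ → ContinuousMultilinearMap 𝕜 (fun _ : Fin n => E) F}
    {A₀ : ContinuousMultilinearMap 𝕜 (fun _ : Fin n => E) F} {x : ℕ → E} {a : E}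
    (hA : weakNorm 𝕜 1 (fun j => A j - A₀) ≠ ∞) (hx : weakNorm 𝕜 1 (fun j => x j - a) ≠ ∞) :
    weakNorm 𝕜 1 (fun j => A j (fun _ => x j) - A₀ (fun _ => a)) ≠ ∞ := by
  induction n with
  | zero =>
    have heval := weakNorm_one_map_ne_top
      (ContinuousMultilinearMap.apply 𝕜 (fun _ : Fin 0 => E) F 0) hA
    have hconst (z : E) : (fun _ : Fin 0 => z) = 0 := Subsingleton.elim _ _
    simpa only [hconst, map_sub, ContinuousMultilinearMap.apply_apply] using heval
  | succ n ih =>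
    have hcurry (L : ContinuousMultilinearMap 𝕜 (fun _ : Fin (n + 1) => E) F) (z : E) :
        L (fun _ => z) = L.curryLeft z (fun _ => z) := by
      rw [ContinuousMultilinearMap.curryLeft_apply]
      exact congrArg L (funext fun i => by refine Fin.cases ?_ (fun _ => ?_) i <;> simp)
    simp only [hcurry]
    exact ih (weakNorm_one_bilinear_sub_ne_top
      (continuousMultilinearCurryLeftEquiv 𝕜 (fun _ : Fin (n + 1) => E)
        F).toContinuousLinearEquiv.toContinuousLinearMap hA hx)

theorem weakNorm_one_le_sum_enorm_add_tail (x : ℕ → E) (N : ℕ) :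
    weakNorm 𝕜 1 x ≤ ∑ j ∈ Finset.range N, ‖x j‖ₑ + weakNorm 𝕜 1 fun j => x (N + j) := by
  rw [weakNorm_one_eq_iSup x]
  refine iSup₂_le fun φ hφ => ?_
  rw [← ENNReal.summable.sum_add_tsum_nat_add' (k := N)]
  refine add_le_add (Finset.sum_le_sum fun j _ => ?_) ?_
  · exact enorm_le_iff_norm_le.2 (by simpa using φ.le_of_opNorm_le hφ (x j))
  · simpa only [add_comm] using tsum_enorm_le_weakNorm_one (fun j => x (N + j)) hφ

theorem weakNorm_one_ne_top_of_tendsto {x : ℕ → E}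
    (hx : Tendsto (fun k => weakNorm 𝕜 1 fun j => x (k + j)) atTop (𝓝 0)) :
    weakNorm 𝕜 1 x ≠ ∞ := by
  obtain ⟨N, hN⟩ := (hx.eventually (gt_mem_nhds ENNReal.zero_lt_top)).exists
  exact ne_top_of_le_ne_top (ENNReal.add_ne_top.2 ⟨by simp, hN.ne⟩)
    (weakNorm_one_le_sum_enorm_add_tail x N)

theorem unconditionallySummable_one_iff {x : ℕ → E} :
    UnconditionallySummable 𝕜 1 x ↔
      Tendsto (fun k => weakNorm 𝕜 1 fun j => x (k + j)) atTop (𝓝 0) := by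
  refine ⟨And.right, fun h => ⟨fun φ => ?_, h⟩⟩
  rw [memℓp_one_iff_summable_norm, summable_norm_iff_tsum_enorm_ne_top]
  exact ne_top_of_le_ne_top (weakNorm_one_map_ne_top φ (weakNorm_one_ne_top_of_tendsto h))
    (tsum_enorm_le_weakNorm_one_self _)

theorem UnconditionallySummable.tendsto_zero {x : ℕ → E}
    (hx : UnconditionallySummable 𝕜 1 x) : Tendsto x atTop (𝓝 0) := by
  rw [tendsto_zero_iff_enorm_tendsto_zero]
  refine tendsto_of_tendsto_of_tendsto_of_le_of_le tendsto_const_nhds hx.2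
    (fun _ => zero_le) fun k => ?_
  simpa using enorm_sum_smul_le_weakNorm_one (𝕜 := 𝕜) (fun j => x (k + j)) {0}
    (c := fun _ => 1) (by simp)

end WeakNorm

section SummingSet

variable {𝕜 : Type*} [RCLike 𝕜]
variable {E : Type*} [NormedAddCommGroup E] [NormedSpace 𝕜 E]
variable {F : Type*} [NormedAddCommGroup F]

theorem mem_summingSetOne_iff {f : E → F} {a : E} :
    a ∈ summingSetOne 𝕜 f ↔
      ∀ x : ℕ → E, UnconditionallySummable 𝕜 1 x → Summable fun j => ‖f (a + x j) - f a‖ :=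
  forall₂_congr fun _ _ => memℓp_one_iff_summable_norm

variable [NormedSpace 𝕜 F]

theorem IsHomogeneousPolynomial.mem_summingSetOne {n : ℕ} {P : E → 𝕜}
    (hP : IsHomogeneousPolynomial 𝕜 n P) (a : E) : a ∈ summingSetOne 𝕜 P := by
  obtain ⟨A, hA⟩ := hP
  refine mem_summingSetOne_iff.2 fun x hx => summable_norm_iff_tsum_enorm_ne_top.2 ?_
  refine ne_top_of_le_ne_top ?_ (tsum_enorm_le_weakNorm_one_self _)
  simp only [hA]
  refine weakNorm_one_multilinear_diagonal_sub_ne_top (A := fun _ => A) ?_ ?_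
  · simp [weakNorm_one_eq_iSup]
  · simpa using weakNorm_one_ne_top_of_tendsto hx.2

theorem smul_mem_summingSetOne_of_eq_zero {P : E → 𝕜} {g : E → F} {a : E}
    (hP : a ∈ summingSetOne 𝕜 P) (hg : ContinuousAt g a) (ha : P a = 0) :
    a ∈ summingSetOne 𝕜 fun x => P x • g x := by
  refine mem_summingSetOne_iff.2 fun x hx => ?_
  have hlim : Tendsto (fun j => g (a + x j)) atTop (𝓝 (g a)) :=
    hg.tendsto.comp (by simpa using hx.tendsto_zero.const_add a)
  obtain ⟨M, hM⟩ := hlim.norm.bddAbove_range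
  refine ((mem_summingSetOne_iff.1 hP x hx).mul_right M).of_nonneg_of_le
    (fun _ => norm_nonneg _) fun j => ?_
  simp only [ha, zero_smul, sub_zero, norm_smul]
  exact mul_le_mul_of_nonneg_left (hM ⟨j, rfl⟩) (norm_nonneg _)

theorem IsHomogeneousPolynomial.continuous {n : ℕ} {P : E → F}
    (hP : IsHomogeneousPolynomial 𝕜 n P) : Continuous P := by
  obtain ⟨A, hA⟩ := hP
  rw [funext hA]
  fun_prop

theorem spaceable_of_isClosed {Z A : Set E} (hZ : IsClosed Z) (hZA : Z ⊆ A)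
    {W : Submodule 𝕜 E} (hW : ¬ FiniteDimensional 𝕜 W) (hWZ : (W : Set E) ⊆ Z) :
    Spaceable 𝕜 A :=
  ⟨W.topologicalClosure, W.isClosed_topologicalClosure,
    fun _ => hW (Submodule.finiteDimensional_of_le W.le_topologicalClosure),
    ((closure_minimal hWZ hZ).trans hZA).trans Set.subset_union_left⟩

theorem IsHomogeneousPolynomial.spaceable_summingSetOne_smul {n : ℕ} {P : E → 𝕜}
    (hP : IsHomogeneousPolynomial 𝕜 n P) {g : E → F} (hg : Continuous g) {W : Submodule 𝕜 E}
    (hW : ¬ FiniteDimensional 𝕜 W) (hPW : ∀ w ∈ W, P w = 0) :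
    Spaceable 𝕜 (summingSetOne 𝕜 fun x => P x • g x) :=
  spaceable_of_isClosed (isClosed_singleton.preimage hP.continuous)
    (fun a ha => smul_mem_summingSetOne_of_eq_zero (hP.mem_summingSetOne a) hg.continuousAt ha)
    hW hPW

end SummingSet

section Zeros

variable {K E : Type*} [Field K] [AddCommGroup E] [Module K E]

theorem exists_mem_notMem_of_finiteDimensional {V : Submodule K E} (hV : ¬ FiniteDimensional K V)
    (U : Submodule K E) [FiniteDimensional K U] : ∃ y ∈ V, y ∉ U := by
  by_contra! hle
  exact hV (Submodule.finiteDimensional_of_le hle)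

theorem exists_infinite_submodule_subset_of_step {Z : Set E} (h0 : 0 ∈ Z)
    (hstep : ∀ W : Submodule K E, FiniteDimensional K W → (W : Set E) ⊆ Z →
      ∃ y ∉ W, ((W ⊔ K ∙ y : Submodule K E) : Set E) ⊆ Z) :
    ∃ W : Submodule K E, ¬ FiniteDimensional K W ∧ (W : Set E) ⊆ Z := by
  obtain ⟨W, hWZ, hmax⟩ := zorn_le₀ {W : Submodule K E | (W : Set E) ⊆ Z} fun c hc hchain => by
    rcases c.eq_empty_or_nonempty with rfl | hne
    · exact ⟨⊥, by simpa using h0, by simp⟩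
    · refine ⟨sSup c, fun w hw => ?_, fun _ => le_sSup⟩
      obtain ⟨V, hV, hwV⟩ := (Submodule.mem_sSup_of_directed hne hchain.directedOn).1 hw
      exact hc hV hwV
  refine ⟨W, fun hW => ?_, hWZ⟩
  obtain ⟨y, hyW, hy⟩ := hstep W hW hWZ
  exact hyW (hmax hy le_sup_left (Submodule.mem_sup_right (Submodule.mem_span_singleton_self y)))

/-- Every infinite-dimensional subspace contains an infinite-dimensional subspace on which `p`
vanishes. -/
def HereditarilyVanishing (K : Type*) {E : Type*} [Field K] [AddCommGroup E] [Module K E]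
    (p : E → K) : Prop :=
  ∀ V : Submodule K E, ¬ FiniteDimensional K V →
    ∃ W ≤ V, ¬ FiniteDimensional K W ∧ ∀ w ∈ W, p w = 0

theorem HereditarilyVanishing.exists_forall {κ : Type*} {p : κ → E → K}
    (hp : ∀ k, HereditarilyVanishing K (p k)) (T : Finset κ) {V : Submodule K E}
    (hV : ¬ FiniteDimensional K V) :
    ∃ W ≤ V, ¬ FiniteDimensional K W ∧ ∀ k ∈ T, ∀ w ∈ W, p k w = 0 := by
  classical
  induction T using Finset.induction_on with
  | empty => exact ⟨V, le_rfl, hV, by simp⟩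
  | insert k T _ ih =>
    obtain ⟨W₁, hW₁V, hW₁, hvanish⟩ := ih
    obtain ⟨W₂, hW₂W₁, hW₂, hk⟩ := hp k W₁ hW₁
    refine ⟨W₂, hW₂W₁.trans hW₁V, hW₂, fun l hl w hw => ?_⟩
    rcases Finset.mem_insert.1 hl with rfl | hl
    · exact hk w hw
    · exact hvanish l hl w (hW₂W₁ hw)

section Multilinear

variable {ι : Type*} (A : MultilinearMap K (fun _ : ι => E) K)

theorem domDomRestrict_eq_zero_of_basis [Finite ι] {P : ι → Prop} [DecidablePred P]
    {W : Submodule K E} {r : Type*} (b : Module.Basis r K W) {y : E}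
    (hb : ∀ e : {i // ¬ P i} → r, A.domDomRestrict P (fun i => b (e i)) (fun _ => y) = 0)
    (w : {i // ¬ P i} → W) : A.domDomRestrict P (fun i => w i) (fun _ => y) = 0 := by
  let evalDiagonal : MultilinearMap K (fun _ : {i // P i} => E) K →ₗ[K] K :=
    { toFun := fun L => L fun _ => y
      map_add' := fun _ _ => rfl
      map_smul' := fun _ _ => rfl }
  have hzero : (evalDiagonal.compMultilinearMap (A.domDomRestrictₗ P)).compLinearMap
      (fun _ => W.subtype) = 0 :=
    Module.Basis.ext_multilinear (fun _ => b) hb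
  exact congrArg (fun L : MultilinearMap K (fun _ : {i // ¬ P i} => W) K => L w) hzero

variable [Fintype ι]

theorem diagonal_smul (c : K) (y : E) :
    A (fun _ => c • y) = c ^ Fintype.card ι * A (fun _ => y) := by
  simpa using A.map_smul_univ (fun _ => c) (fun _ => y)

variable [DecidableEq ι]

theorem exists_submodule_forall_diagonal_add [Nonempty ι]
    (hA : ∀ s : Finset ι, s.Nonempty → s ≠ Finset.univ → ∀ z : {i // i ∉ s} → E,
      HereditarilyVanishing K fun y => A.domDomRestrict (· ∈ s) z (fun _ => y))
    {V : Submodule K E} (hV : ¬ FiniteDimensional K V) (W : Submodule K E)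
    [FiniteDimensional K W] :
    ∃ V' ≤ V, ¬ FiniteDimensional K V' ∧ ∀ w ∈ W, ∀ y ∈ V',
      A (fun _ => w + y) = A (fun _ => w) + A (fun _ => y) := by
  let b := Module.finBasis K W
  obtain ⟨V', hV'V, hV', hvanish⟩ := HereditarilyVanishing.exists_forall
    (κ := Σ s : {s : Finset ι // s.Nonempty ∧ s ≠ Finset.univ}, {i // i ∉ s.1} → Fin _)
    (fun k => hA k.1 k.1.2.1 k.1.2.2 fun i => b (k.2 i)) Finset.univ hV
  refine ⟨V', hV'V, hV', fun w hw y hy => ?_⟩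
  have hmixed (s : Finset ι) (hs : s ≠ ∅ ∧ s ≠ Finset.univ) :
      A (s.piecewise (fun _ => y) (fun _ => w)) = 0 := by
    have h := domDomRestrict_eq_zero_of_basis A (P := (· ∈ s)) b
      (fun e => hvanish ⟨⟨s, Finset.nonempty_iff_ne_empty.2 hs.1, hs.2⟩, e⟩
        (Finset.mem_univ _) y hy) (fun _ => ⟨w, hw⟩)
    rwa [MultilinearMap.domDomRestrict_apply] at h
  calc A (fun _ => w + y) = A ((fun _ => y) + fun _ => w) :=
        congrArg A (funext fun _ => add_comm w y)
    _ = ∑ s : Finset ι, A (s.piecewise (fun _ => y) (fun _ => w)) := A.map_add_univ _ _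
    _ = A (fun _ => w) + A (fun _ => y) := by
        rw [Fintype.sum_eq_add ∅ Finset.univ Finset.univ_nonempty.ne_empty.symm hmixed]
        simp only [Finset.piecewise_empty, Finset.piecewise_univ]

theorem exists_mem_notMem_diagonal_eq_zero [IsAlgClosed K] [Nonempty ι]
    (hA : ∀ s : Finset ι, s.Nonempty → s ≠ Finset.univ → ∀ z : {i // i ∉ s} → E,
      HereditarilyVanishing K fun y => A.domDomRestrict (· ∈ s) z (fun _ => y))
    {V : Submodule K E} (hV : ¬ FiniteDimensional K V) (W : Submodule K E)
    [FiniteDimensional K W] : ∃ y ∈ V, y ∉ W ∧ A (fun _ => y) = 0 := by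
  obtain ⟨y₁, hy₁V, hy₁W⟩ := exists_mem_notMem_of_finiteDimensional hV W
  obtain ⟨V', hV'V, hV', hadd⟩ := exists_submodule_forall_diagonal_add A hA hV (K ∙ y₁)
  obtain ⟨y₂, hy₂V', hy₂W⟩ := exists_mem_notMem_of_finiteDimensional hV' (W ⊔ K ∙ y₁)
  rcases eq_or_ne (A fun _ => y₁) 0 with h₁ | h₁
  · exact ⟨y₁, hy₁V, hy₁W, h₁⟩
  · obtain ⟨t, ht⟩ := IsAlgClosed.exists_pow_nat_eq (-(A fun _ => y₂) / A fun _ => y₁)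
      (Fintype.card_pos (α := ι))
    have hty₁ : t • y₁ ∈ K ∙ y₁ := Submodule.smul_mem _ _ (Submodule.mem_span_singleton_self _)
    refine ⟨t • y₁ + y₂, V.add_mem (V.smul_mem _ hy₁V) (hV'V hy₂V'), fun hW => hy₂W ?_, ?_⟩
    · exact (Submodule.add_mem_iff_right _ (Submodule.mem_sup_right hty₁)).1
        (Submodule.mem_sup_left hW)
    · rw [hadd _ hty₁ _ hy₂V', diagonal_smul, ht, div_mul_cancel₀ _ h₁, neg_add_cancel]

theorem hereditarilyVanishing_diagonal_of_restrictions [IsAlgClosed K] [Nonempty ι]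
    (hA : ∀ s : Finset ι, s.Nonempty → s ≠ Finset.univ → ∀ z : {i // i ∉ s} → E,
      HereditarilyVanishing K fun y => A.domDomRestrict (· ∈ s) z (fun _ => y)) :
    HereditarilyVanishing K fun y => A (fun _ => y) := by
  intro V hV
  suffices ∃ W : Submodule K E, ¬ FiniteDimensional K W ∧
      (W : Set E) ⊆ {w | w ∈ V ∧ A (fun _ => w) = 0} by
    obtain ⟨W, hW, hWV⟩ := this
    exact ⟨W, fun w hw => (hWV hw).1, hW, fun w hw => (hWV hw).2⟩
  refine exists_infinite_submodule_subset_of_step ⟨V.zero_mem, A.map_zero⟩ fun W hWfin hWV => ?_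
  obtain ⟨V', hV'V, hV', hadd⟩ := exists_submodule_forall_diagonal_add A hA hV W
  obtain ⟨y, hyV', hyW, hAy⟩ := exists_mem_notMem_diagonal_eq_zero A hA hV' W
  refine ⟨y, hyW, fun x hx => ?_⟩
  obtain ⟨w, hw, _, hz, rfl⟩ := Submodule.mem_sup.1 hx
  obtain ⟨c, rfl⟩ := Submodule.mem_span_singleton.1 hz
  obtain ⟨hwV, hAw⟩ := hWV hw
  have hcy : c • y ∈ V' := V'.smul_mem c hyV'
  exact ⟨V.add_mem hwV (hV'V hcy), by
    rw [hadd w hw _ hcy, diagonal_smul, hAw, hAy, mul_zero, add_zero]⟩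

end Multilinear

theorem hereditarilyVanishing_diagonal [IsAlgClosed K] {ι : Type*} [Finite ι] [Nonempty ι]
    (A : MultilinearMap K (fun _ : ι => E) K) :
    HereditarilyVanishing K fun y => A (fun _ => y) := by
  classical
  have := Fintype.ofFinite ι
  induction hn : Fintype.card ι using Nat.strong_induction_on generalizing ι with
  | _ n ih =>
    refine hereditarilyVanishing_diagonal_of_restrictions A fun s hs hs_univ z => ?_
    have : Nonempty {i // i ∈ s} := hs.to_subtype
    refine ih _ ?_ (A.domDomRestrict (· ∈ s) z) inferInstance rfl
    rw [← hn, Fintype.card_coe]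
    exact s.card_lt_iff_ne_univ.2 hs_univ

end Zeros

theorem IsHomogeneousPolynomial.hereditarilyVanishing {E : Type*} [NormedAddCommGroup E]
    [NormedSpace ℂ E] {n : ℕ} [NeZero n] {P : E → ℂ} (hP : IsHomogeneousPolynomial ℂ n P) :
    HereditarilyVanishing ℂ P := by
  obtain ⟨A, hA⟩ := hP
  rw [funext hA]
  exact hereditarilyVanishing_diagonal A.toMultilinearMap

section Polynomials

variable {𝕜 : Type*} [RCLike 𝕜]
variable {E : Type*} [NormedAddCommGroup E] [NormedSpace 𝕜 E]
variable {F : Type*} [NormedAddCommGroup F] [NormedSpace 𝕜 F]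
variable {G : Type*} [NormedAddCommGroup G] [NormedSpace 𝕜 G]

theorem isHomogeneousPolynomial_one_id : IsHomogeneousPolynomial 𝕜 1 (id : E → E) :=
  ⟨ContinuousMultilinearMap.ofSubsingleton 𝕜 E E 0 (.id 𝕜 E), fun _ => rfl⟩

theorem IsHomogeneousPolynomial.bilinear_apply_self {n : ℕ} {P : E → G}
    (hP : IsHomogeneousPolynomial 𝕜 n P) (B : G →L[𝕜] E →L[𝕜] F) :
    IsHomogeneousPolynomial 𝕜 (n + 1) fun x => B (P x) x := by
  obtain ⟨A, hA⟩ := hP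
  refine ⟨(B.compContinuousMultilinearMap A).uncurryRight, fun x => ?_⟩
  simp only [hA, ContinuousMultilinearMap.uncurryRight_apply]
  rfl

theorem isHomogeneousPolynomial_two_apply_self (B : E →L[𝕜] E →L[𝕜] F) :
    IsHomogeneousPolynomial 𝕜 2 fun x => B x x :=
  isHomogeneousPolynomial_one_id.bilinear_apply_self B

theorem IsHomogeneousPolynomial.smul_self {n : ℕ} {P : E → 𝕜}
    (hP : IsHomogeneousPolynomial 𝕜 n P) : IsHomogeneousPolynomial 𝕜 (n + 1) fun x => P x • x :=
  hP.bilinear_apply_self (ContinuousLinearMap.lsmul 𝕜 𝕜)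

theorem IsHomogeneousPolynomial.exists_bilinear {P : E → F}
    (hP : IsHomogeneousPolynomial 𝕜 2 P) : ∃ B : E →L[𝕜] E →L[𝕜] F, ∀ x, P x = B x x := by
  obtain ⟨A, hA⟩ := hP
  refine ⟨(continuousMultilinearCurryFin1 𝕜 E F).toContinuousLinearEquiv.toContinuousLinearMap.comp
    (ContinuousMultilinearMap.curryLeft (n := 1) A), fun x => ?_⟩
  rw [hA]
  exact congrArg A (funext fun i => by fin_cases i <;> rfl)

end Polynomials

theorem posDef_or_neg_posDef_of_anisotropic {M : Type*} [AddCommGroup M] [Module ℝ M]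
    {Q : QuadraticForm ℝ M} (hQ : Q.Anisotropic) : Q.PosDef ∨ (-Q).PosDef := by
  by_contra! hindef
  obtain ⟨hpos, hneg⟩ := hindef
  simp only [QuadraticMap.PosDef, not_forall, not_lt, neg_apply,
    Left.neg_nonpos_iff] at hpos hneg
  obtain ⟨y, hy, hQy⟩ := hpos
  obtain ⟨x, hx, hQx⟩ := hneg
  replace hQy : Q y < 0 := hQy.lt_of_ne fun h => hy (hQ y h)
  have hline (t : ℝ) : Q (x + t • y) = Q y * (t * t) + QuadraticMap.polar Q x y * t + Q x := by
    rw [QuadraticMap.map_add Q, QuadraticMap.map_smul, QuadraticMap.polar_smul_right, smul_eq_mul,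
      smul_eq_mul]
    ring
  have hdiscrim : 0 ≤ discrim (Q y) (QuadraticMap.polar Q x y) (Q x) := by
    rw [discrim]
    nlinarith [sq_nonneg (QuadraticMap.polar Q x y), mul_nonneg hQx (neg_nonneg.2 hQy.le)]
  obtain ⟨t, ht⟩ := exists_quadratic_eq_zero hQy.ne ⟨_, (Real.mul_self_sqrt hdiscrim).symm⟩
  have hx_eq : x = -(t • y) := eq_neg_of_add_eq_zero_left (hQ _ ((hline t).trans ht))
  have hQx_eq : Q x = t * t * Q y := by
    rw [hx_eq, QuadraticMap.map_neg, QuadraticMap.map_smul, smul_eq_mul]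
  have hQx_nonpos : Q x ≤ 0 := hQx_eq ▸ mul_nonpos_of_nonneg_of_nonpos (mul_self_nonneg t) hQy.le
  exact hx (hQ x (hQx_nonpos.antisymm hQx))

section RealQuadratic

/-- There is a bounded, positive definite bilinear form on `E`; it may be weaker than the norm. -/
def AdmitsPosDefForm (E : Type*) [NormedAddCommGroup E] [NormedSpace ℝ E] : Prop :=
  ∃ Q : E →L[ℝ] E →L[ℝ] ℝ, ∀ x ≠ 0, 0 < Q x x

variable {E : Type*} [NormedAddCommGroup E] [NormedSpace ℝ E]
variable {G : Type*} [NormedAddCommGroup G] [NormedSpace ℝ G] [FiniteDimensional ℝ G]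

theorem AdmitsPosDefForm.of_pos_on_ker (B : E →L[ℝ] E →L[ℝ] ℝ) (f : E →L[ℝ] G)
    (hB : ∀ y, f y = 0 → y ≠ 0 → 0 < B y y) : AdmitsPosDefForm E := by
  obtain ⟨π, hπ⟩ := f.ker_closedComplemented_of_finiteDimensional_range
  let p : E →L[ℝ] E := (Submodule.subtypeL _).comp π
  let g : E →L[ℝ] EuclideanSpace ℝ (Fin (Module.finrank ℝ G)) :=
    (toEuclidean : G ≃L[ℝ] _).toContinuousLinearMap.comp f
  have hp_nonneg (x : E) : 0 ≤ B (p x) (p x) := by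
    rcases eq_or_ne (p x) 0 with hpx | hpx
    · simp [hpx]
    · exact (hB (p x) (π x).2 hpx).le
  let I : E →L[ℝ] E →L[ℝ] ℝ := ContinuousLinearMap.bilinearComp (innerSL ℝ) g g
  have hI (x : E) : I x x = ‖g x‖ ^ 2 := real_inner_self_eq_norm_sq (g x)
  refine ⟨B.bilinearComp p p + I, fun x hx => ?_⟩
  simp only [add_apply, ContinuousLinearMap.bilinearComp_apply, hI]
  by_cases hfx : f x = 0
  · have hpx : p x = x := congrArg Subtype.val (hπ ⟨x, hfx⟩)
    rw [hpx]
    exact add_pos_of_pos_of_nonneg (hB x hfx hx) (sq_nonneg _)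
  · have hgx : g x ≠ 0 := fun h => hfx ((toEuclidean : G ≃L[ℝ] _).map_eq_zero_iff.1 h)
    exact add_pos_of_nonneg_of_pos (hp_nonneg x) (pow_pos (norm_pos_iff.2 hgx) 2)

theorem AdmitsPosDefForm.of_anisotropic_on_ker (B : E →L[ℝ] E →L[ℝ] ℝ) (f : E →L[ℝ] G)
    (hB : ∀ y, f y = 0 → B y y = 0 → y = 0) : AdmitsPosDefForm E := by
  let Q : QuadraticForm ℝ (LinearMap.ker f.toLinearMap) :=
    (LinearMap.BilinMap.toQuadraticMap B.toLinearMap₁₂).comp (Submodule.subtype _)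
  have hQ : Q.Anisotropic := fun y hy => Subtype.ext (hB y y.2 hy)
  rcases posDef_or_neg_posDef_of_anisotropic hQ with hpos | hneg
  · exact .of_pos_on_ker B f fun y hfy hy => hpos ⟨y, hfy⟩ (Subtype.coe_ne_coe.1 hy)
  · exact .of_pos_on_ker (-B) f fun y hfy hy => hneg ⟨y, hfy⟩ (Subtype.coe_ne_coe.1 hy)

theorem exists_notMem_isotropic_sup_span (hE : ¬ AdmitsPosDefForm E) (B : E →L[ℝ] E →L[ℝ] ℝ)
    (W : Submodule ℝ E) [FiniteDimensional ℝ W] (hW : ∀ w ∈ W, B w w = 0) :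
    ∃ y ∉ W, ∀ x ∈ W ⊔ ℝ ∙ y, B x x = 0 := by
  obtain ⟨π, hπ⟩ := Submodule.ClosedComplemented.of_finiteDimensional (𝕜 := ℝ) W
  let D : E →L[ℝ] W →L[ℝ] ℝ := (B + B.flip).bilinearComp (.id ℝ E) W.subtypeL
  have : FiniteDimensional ℝ (W →L[ℝ] ℝ) :=
    (LinearMap.toContinuousLinearMap : (W →ₗ[ℝ] ℝ) ≃ₗ[ℝ] _).finiteDimensional
  obtain ⟨y, hfy, hyy, hy⟩ : ∃ y, π.prod D y = 0 ∧ B y y = 0 ∧ y ≠ 0 := by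
    by_contra! hanisotropic
    exact hE (.of_anisotropic_on_ker (G := W × (W →L[ℝ] ℝ)) B (π.prod D) hanisotropic)
  obtain ⟨hπy, hDy⟩ : π y = 0 ∧ D y = 0 := Prod.mk_eq_zero.1 hfy
  refine ⟨y, fun hyW => hy ?_, fun x hx => ?_⟩
  · exact congrArg Subtype.val ((hπ ⟨y, hyW⟩).symm.trans hπy)
  · obtain ⟨w, hw, _, hz, rfl⟩ := Submodule.mem_sup.1 hx
    obtain ⟨t, rfl⟩ := Submodule.mem_span_singleton.1 hz
    have hcross : B y w + B w y = 0 := congrArg (fun L : W →L[ℝ] ℝ => L ⟨w, hw⟩) hDy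
    simp only [map_add, map_smul, add_apply, smul_apply, smul_eq_mul]
    linear_combination hW w hw + t * hcross + t ^ 2 * hyy

theorem exists_infinite_isotropic_of_not_admitsPosDefForm (hE : ¬ AdmitsPosDefForm E)
    (B : E →L[ℝ] E →L[ℝ] ℝ) :
    ∃ W : Submodule ℝ E, ¬ FiniteDimensional ℝ W ∧ ∀ w ∈ W, B w w = 0 :=
  exists_infinite_submodule_subset_of_step (Z := {x | B x x = 0}) (by simp)
    fun W _ hW => exists_notMem_isotropic_sup_span hE B W hW

end RealQuadratic

section DvoretzkyRogersLemma

theorem det_smul_add_smul_of_isProj {K M : Type*} [Field K] [AddCommGroup M] [Module K M]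
    [FiniteDimensional K M] {V : Submodule K M} {f : M →ₗ[K] M} (hf : LinearMap.IsProj V f)
    (a b : K) :
    LinearMap.det (a • f + b • (LinearMap.id - f)) =
      a ^ Module.finrank K V * b ^ (Module.finrank K M - Module.finrank K V) := by
  have hV : V ≤ V.comap (a • f + b • (LinearMap.id - f)) := fun x hx => by
    simpa [hf.map_id x hx] using V.smul_mem a hx
  have h_restrict : (a • f + b • (LinearMap.id - f)).restrict hV = a • LinearMap.id := by
    ext x
    simp [hf.map_id x x.2]
  have h_quotient : V.mapQ V (a • f + b • (LinearMap.id - f)) hV = b • LinearMap.id := by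
    ext x
    simp [(Submodule.Quotient.mk_eq_zero V).2 (hf.map_mem x)]
  rw [LinearMap.det_eq_det_mul_det V _ hV, h_restrict, h_quotient, LinearMap.det_smul,
    LinearMap.det_smul, LinearMap.det_id, LinearMap.det_id, mul_one, mul_one,
    Submodule.finrank_quotient]

variable {𝕜 : Type*} [RCLike 𝕜]

theorem exists_norm_le_one_forall_norm_det_le_one {H X : Type*} [NormedAddCommGroup H]
    [NormedSpace 𝕜 H] [FiniteDimensional 𝕜 H] [NormedAddCommGroup X] [NormedSpace 𝕜 X]
    [FiniteDimensional 𝕜 X] (hHX : Module.finrank 𝕜 H = Module.finrank 𝕜 X) :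
    ∃ u : H →L[𝕜] X, ‖u‖ ≤ 1 ∧ ∀ T : H →L[𝕜] H, ‖u.comp T‖ ≤ 1 → ‖T.det‖ ≤ 1 := by
  let e : H ≃L[𝕜] X := ContinuousLinearEquiv.ofFinrankEq hHX
  let vol : (H →L[𝕜] X) → ℝ := fun u => ‖((e.symm : X →L[𝕜] H).comp u).det‖
  have h_comp (u : H →L[𝕜] X) (T : H →L[𝕜] H) : vol (u.comp T) = vol u * ‖T.det‖ := by
    have h : ((e.symm : X →L[𝕜] H).comp (u.comp T)).det =
        ((e.symm : X →L[𝕜] H).comp u).det * T.det :=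
      LinearMap.det_comp (((e.symm : X →L[𝕜] H).comp u : H →L[𝕜] H) : H →ₗ[𝕜] H) (T : H →ₗ[𝕜] H)
    simp only [vol, h, norm_mul]
  have h_cont : Continuous vol :=
    (ContinuousLinearMap.continuous_det.comp (continuous_const.clm_comp continuous_id)).norm
  have := FiniteDimensional.proper 𝕜 (H →L[𝕜] X)
  obtain ⟨u, hu, hmax⟩ := (isCompact_closedBall (0 : H →L[𝕜] X) 1).exists_isMaxOn
    ⟨0, Metric.mem_closedBall_self zero_le_one⟩ h_cont.continuousOn
  have h_pos : 0 < vol u := by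
    let c : 𝕜 := ((‖(e : H →L[𝕜] X)‖ + 1 : ℝ) : 𝕜)⁻¹
    have hc : ‖c • (e : H →L[𝕜] X)‖ ≤ 1 := by
      have h : ‖((‖(e : H →L[𝕜] X)‖ + 1 : ℝ) : 𝕜)‖ = ‖(e : H →L[𝕜] X)‖ + 1 :=
        RCLike.norm_of_nonneg (by positivity)
      rw [norm_smul, norm_inv, h, inv_mul_le_one₀ (by positivity)]
      linarith
    have h_det : ((e.symm : X →L[𝕜] H).comp (c • (e : H →L[𝕜] X))).det =
        c ^ Module.finrank 𝕜 H := by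
      rw [ContinuousLinearMap.comp_smul, ContinuousLinearEquiv.coe_symm_comp_coe]
      exact (LinearMap.det_smul c LinearMap.id).trans (by simp)
    have hc_ne : c ≠ 0 := inv_ne_zero (RCLike.ofReal_ne_zero.2 (by positivity))
    refine lt_of_lt_of_le ?_ (hmax (mem_closedBall_zero_iff.2 hc))
    exact norm_pos_iff.2 (h_det ▸ pow_ne_zero _ hc_ne)
  refine ⟨u, mem_closedBall_zero_iff.1 hu, fun T hT => ?_⟩
  refine le_of_mul_le_mul_left ?_ h_pos
  rw [← h_comp, mul_one]
  exact hmax (mem_closedBall_zero_iff.2 hT)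

section

variable {H X : Type*} [NormedAddCommGroup H] [InnerProductSpace 𝕜 H]
variable [NormedAddCommGroup X] [NormedSpace 𝕜 X]

theorem norm_comp_smul_starProjection_add_smul_le (u : H →L[𝕜] X) (V : Submodule 𝕜 H)
    [V.HasOrthogonalProjection] (a b : 𝕜) :
    ‖u.comp (a • V.starProjection + b • (ContinuousLinearMap.id 𝕜 H - V.starProjection))‖ ≤
      ‖a‖ * ‖u.comp V.subtypeL‖ + ‖b‖ * ‖u‖ := by
  have h_split :
      u.comp (a • V.starProjection + b • (ContinuousLinearMap.id 𝕜 H - V.starProjection)) =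
        a • (u.comp V.subtypeL).comp V.orthogonalProjectionOnto + b • u.comp Vᗮ.starProjection := by
    rw [Submodule.starProjection_orthogonal]
    ext x
    simp
  have hV : ‖(u.comp V.subtypeL).comp V.orthogonalProjectionOnto‖ ≤ ‖u.comp V.subtypeL‖ :=
    (ContinuousLinearMap.opNorm_comp_le _ _).trans
      (mul_le_of_le_one_right (norm_nonneg _) V.orthogonalProjectionOnto_norm_le)
  have hV_orth : ‖u.comp Vᗮ.starProjection‖ ≤ ‖u‖ :=
    (ContinuousLinearMap.opNorm_comp_le _ _).trans
      (mul_le_of_le_one_right (norm_nonneg _) Vᗮ.starProjection_norm_le)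
  rw [h_split]
  refine (norm_add_le _ _).trans ?_
  rw [norm_smul, norm_smul]
  gcongr

theorem sum_norm_sq_apply_orthonormal_le [CompleteSpace H] {ι : Type*} {v : ι → H}
    (hv : Orthonormal 𝕜 v) (ψ : StrongDual 𝕜 H) (s : Finset ι) :
    ∑ i ∈ s, ‖ψ (v i)‖ ^ 2 ≤ ‖ψ‖ ^ 2 := by
  have h_bessel := hv.sum_inner_products_le ((InnerProductSpace.toDual 𝕜 H).symm ψ) (s := s)
  simpa [norm_inner_symm (v _)] using h_bessel

variable [FiniteDimensional 𝕜 H]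

theorem exists_mem_quarter_le_norm_of_two_mul_finrank_lt {u : H →L[𝕜] X} (hu : ‖u‖ ≤ 1)
    (hdet : ∀ T : H →L[𝕜] H, ‖u.comp T‖ ≤ 1 → ‖T.det‖ ≤ 1) {V : Submodule 𝕜 H}
    (hV : Module.finrank 𝕜 H < 2 * Module.finrank 𝕜 V) :
    ∃ x ∈ V, ‖x‖ = 1 ∧ 1 / 4 ≤ ‖u x‖ := by
  by_contra! hcon
  have h_small : ‖u.comp V.subtypeL‖ ≤ 1 / 4 :=
    ContinuousLinearMap.opNorm_le_of_unit_norm (by norm_num) fun x hx => (hcon x x.2 hx).le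
  let T : H →L[𝕜] H := (2 : 𝕜) • V.starProjection +
    (2⁻¹ : 𝕜) • (ContinuousLinearMap.id 𝕜 H - V.starProjection)
  have hT_norm : ‖u.comp T‖ ≤ 1 := by
    refine (norm_comp_smul_starProjection_add_smul_le u V 2 2⁻¹).trans ?_
    rw [norm_inv, RCLike.norm_two]
    linarith
  have h_proj : LinearMap.IsProj V (V.starProjection : H →ₗ[𝕜] H) :=
    ⟨V.starProjection_apply_mem, fun _ => Submodule.starProjection_eq_self_iff.2⟩
  have hT_det : T.det = 2 ^ Module.finrank 𝕜 V *
      2⁻¹ ^ (Module.finrank 𝕜 H - Module.finrank 𝕜 V) :=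
    det_smul_add_smul_of_isProj h_proj 2 2⁻¹
  have h_le : (2 : ℝ) ^ Module.finrank 𝕜 V ≤ 2 ^ (Module.finrank 𝕜 H - Module.finrank 𝕜 V) := by
    have := hdet T hT_norm
    rwa [hT_det, inv_pow, ← div_eq_mul_inv, norm_div, norm_pow, norm_pow, RCLike.norm_two,
      div_le_one (by positivity)] at this
  have := (pow_le_pow_iff_right₀ one_lt_two).1 h_le
  omega

theorem exists_orthonormal_of_two_mul_le_finrank {p : H → Prop}
    (hp : ∀ V : Submodule 𝕜 H, Module.finrank 𝕜 H < 2 * Module.finrank 𝕜 V →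
      ∃ x ∈ V, ‖x‖ = 1 ∧ p x) {m : ℕ} (hm : 2 * m ≤ Module.finrank 𝕜 H) :
    ∃ v : Fin m → H, Orthonormal 𝕜 v ∧ ∀ i, p (v i) := by
  induction m with
  | zero => exact ⟨Fin.elim0, ⟨fun i => i.elim0, fun i => i.elim0⟩, fun i => i.elim0⟩
  | succ m ih =>
    obtain ⟨v, hv, hpv⟩ := ih (by omega)
    have h_span : Module.finrank 𝕜 (Submodule.span 𝕜 (Set.range v)) ≤ m := by
      simpa [Set.finrank] using finrank_range_le_card (R := 𝕜) v
    have h_orth := Submodule.finrank_add_finrank_orthogonal (Submodule.span 𝕜 (Set.range v))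
    obtain ⟨x, hx, hx_norm, hpx⟩ := hp (Submodule.span 𝕜 (Set.range v))ᗮ (by omega)
    have hxv (i : Fin m) : inner 𝕜 x (v i) = 0 :=
      (Submodule.mem_orthogonal' _ _).1 hx _ (Submodule.subset_span ⟨i, rfl⟩)
    exact ⟨Matrix.vecCons x v, orthonormal_vecCons_iff.2 ⟨hx_norm, hxv, hv⟩,
      Fin.cases hpx hpv⟩

end

variable {E : Type*} [NormedAddCommGroup E] [NormedSpace 𝕜 E]

theorem exists_quarter_le_norm_and_sum_norm_sq_le (hE : ¬ FiniteDimensional 𝕜 E) (m : ℕ) :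
    ∃ e : Fin m → E, (∀ i, 1 / 4 ≤ ‖e i‖) ∧
      ∀ φ : StrongDual 𝕜 E, ∑ i, ‖φ (e i)‖ ^ 2 ≤ ‖φ‖ ^ 2 := by
  have h_rank : ((2 * m : ℕ) : Cardinal) ≤ Module.rank 𝕜 E :=
    Cardinal.natCast_le_aleph0.trans (not_lt.1 fun h => hE (Module.rank_lt_aleph0_iff.1 h))
  obtain ⟨b, hb⟩ := exists_linearIndependent_of_le_rank h_rank
  let X := Submodule.span 𝕜 (Set.range b)
  have : FiniteDimensional 𝕜 X := FiniteDimensional.span_of_finite 𝕜 (Set.finite_range b)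
  obtain ⟨u, hu, hdet⟩ := exists_norm_le_one_forall_norm_det_le_one (𝕜 := 𝕜)
    (H := EuclideanSpace 𝕜 (Fin (2 * m))) (X := X) (by simp [X, finrank_span_eq_card hb])
  obtain ⟨v, hv, huv⟩ := exists_orthonormal_of_two_mul_le_finrank (p := fun x => 1 / 4 ≤ ‖u x‖)
    (fun V => exists_mem_quarter_le_norm_of_two_mul_finrank_lt hu hdet) (m := m) (by simp)
  refine ⟨fun i => u (v i), huv, fun φ => ?_⟩
  have h_norm : ‖(φ.comp X.subtypeL).comp u‖ ≤ ‖φ‖ :=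
    calc ‖(φ.comp X.subtypeL).comp u‖ ≤ ‖φ.comp X.subtypeL‖ * 1 :=
          (ContinuousLinearMap.opNorm_comp_le _ _).trans (by gcongr)
      _ ≤ ‖φ‖ * ‖X.subtypeL‖ := by
          rw [mul_one]
          exact ContinuousLinearMap.opNorm_comp_le _ _
      _ ≤ ‖φ‖ := mul_le_of_le_one_right (norm_nonneg _) X.norm_subtypeL_le
  exact (sum_norm_sq_apply_orthonormal_le hv ((φ.comp X.subtypeL).comp u) _).trans
    (by gcongr)

end DvoretzkyRogersLemma

section DvoretzkyRogersTheorem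

variable {𝕜 : Type*} [RCLike 𝕜] {E : Type*} [NormedAddCommGroup E] [NormedSpace 𝕜 E]

theorem exists_one_le_sum_norm_and_sum_norm_apply_le (hE : ¬ FiniteDimensional 𝕜 E) {ε : ℝ}
    (hε : 0 < ε) :
    ∃ (m : ℕ) (z : Fin m → E), 1 ≤ ∑ i, ‖z i‖ ∧
      ∀ φ : StrongDual 𝕜 E, ‖φ‖ ≤ 1 → ∑ i, ‖φ (z i)‖ ≤ ε := by
  obtain ⟨m, hm⟩ := exists_nat_gt (16 / ε ^ 2)
  have hm_pos : (0 : ℝ) < m := lt_trans (by positivity) hm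
  obtain ⟨e, he_norm, he_sum⟩ := exists_quarter_le_norm_and_sum_norm_sq_le hE m
  have h_scale : ‖((4 / m : ℝ) : 𝕜)‖ = 4 / m := RCLike.norm_of_nonneg (by positivity)
  refine ⟨m, fun i => ((4 / m : ℝ) : 𝕜) • e i, ?_, fun φ hφ => ?_⟩
  · calc (1 : ℝ) = ∑ _i : Fin m, (4 / m : ℝ) * (1 / 4) := by
          rw [Finset.sum_const, Finset.card_univ, Fintype.card_fin, nsmul_eq_mul]
          field_simp
      _ ≤ ∑ i, ‖((4 / m : ℝ) : 𝕜) • e i‖ := by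
          simp only [norm_smul, h_scale]
          gcongr with i
          exact he_norm i
  · have h_cauchy : (∑ i, ‖φ (e i)‖) ^ 2 ≤ m := by
      calc (∑ i, ‖φ (e i)‖) ^ 2 ≤ m * ∑ i, ‖φ (e i)‖ ^ 2 := by
            simpa using sq_sum_le_card_mul_sum_sq (s := Finset.univ) (f := fun i => ‖φ (e i)‖)
        _ ≤ m * 1 ^ 2 := by
            have := he_sum φ
            gcongr
            exact this.trans (by gcongr)
        _ = m := by ring
    have h_sum : ∑ i, ‖φ (((4 / m : ℝ) : 𝕜) • e i)‖ = 4 / m * ∑ i, ‖φ (e i)‖ := by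
      simp only [map_smul, norm_smul, h_scale, Finset.mul_sum]
    rw [h_sum]
    refine (sq_le_sq₀ (by positivity) hε.le).1 ?_
    calc (4 / m * ∑ i, ‖φ (e i)‖) ^ 2 ≤ (4 / m : ℝ) ^ 2 * m := by
          rw [mul_pow]
          gcongr
      _ = 16 / (m : ℝ) := by field_simp; norm_num
      _ ≤ ε ^ 2 := ((div_lt_comm₀ (by positivity) hm_pos).1 hm).le

theorem exists_tsum_nat_add_le_tsum_sum_add {ι : ℕ → Type*} [∀ k, Fintype (ι k)]
    (σ : ℕ ≃ Σ k, ι k) (K : ℕ) :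
    ∃ N, ∀ n ≥ N, ∀ f : (Σ k, ι k) → ℝ≥0∞,
      ∑' j, f (σ (n + j)) ≤ ∑' k, ∑ i, f ⟨k + K, i⟩ := by
  have h_fst : Tendsto (fun j => (σ j).1) atTop atTop := by
    rw [← Nat.cofinite_eq_atTop]
    refine Filter.Tendsto.comp (y := cofinite) ?_ σ.injective.tendsto_cofinite
    refine Filter.Tendsto.cofinite_of_finite_preimage_singleton fun k => ?_
    refine (Set.finite_range fun i : ι k => (⟨k, i⟩ : Σ k, ι k)).subset ?_
    rintro ⟨_, i⟩ rfl
    exact ⟨i, rfl⟩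
  obtain ⟨N, hN⟩ := eventually_atTop.1 (h_fst.eventually_ge_atTop K)
  refine ⟨N, fun n hn f => ?_⟩
  let g : (Σ k, ι k) → ℝ≥0∞ := fun q => if K ≤ q.1 then f q else 0
  calc ∑' j, f (σ (n + j)) = ∑' j, g (σ (n + j)) :=
        tsum_congr fun j => (if_pos (hN _ (by omega))).symm
    _ ≤ ∑' q, g q :=
        ENNReal.tsum_comp_le_tsum_of_injective (σ.injective.comp (add_right_injective n)) g
    _ = ∑' k, ∑ i, g ⟨k, i⟩ := by simp only [ENNReal.tsum_sigma', tsum_fintype]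
    _ = ∑' k, ∑ i, g ⟨k + K, i⟩ := by
        rw [← (ENNReal.summable (f := fun k => ∑ i, g ⟨k + K, i⟩)).sum_add_tsum_nat_add'
          (f := fun k => ∑ i, g ⟨k, i⟩), Finset.sum_eq_zero, zero_add]
        exact fun k hk => Finset.sum_eq_zero fun i _ => if_neg (by simpa using hk)
    _ = ∑' k, ∑ i, f ⟨k + K, i⟩ := by simp [g]

theorem unconditionallySummable_one_of_blocks {ι : ℕ → Type*} [∀ k, Fintype (ι k)]
    {z : (Σ k, ι k) → E} {ε : ℕ → ℝ≥0∞} (hε : ∑' k, ε k ≠ ∞)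
    (hz : ∀ k, ∀ φ : StrongDual 𝕜 E, ‖φ‖ ≤ 1 → ∑ i, ‖φ (z ⟨k, i⟩)‖ₑ ≤ ε k)
    (σ : ℕ ≃ Σ k, ι k) : UnconditionallySummable 𝕜 1 fun j => z (σ j) := by
  refine unconditionallySummable_one_iff.2 (ENNReal.tendsto_nhds_zero.2 fun δ hδ => ?_)
  obtain ⟨K, hK⟩ :=
    (ENNReal.tendsto_nhds_zero.1 (ENNReal.tendsto_sum_nat_add ε hε) δ hδ).exists
  obtain ⟨N, hN⟩ := exists_tsum_nat_add_le_tsum_sum_add σ K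
  filter_upwards [eventually_ge_atTop N] with n hn
  rw [weakNorm_one_eq_iSup]
  exact iSup₂_le fun φ hφ => (hN n hn fun q => ‖φ (z q)‖ₑ).trans
    ((ENNReal.tsum_le_tsum fun k => hz (k + K) φ hφ).trans hK)

theorem not_summable_norm_of_blocks {ι : ℕ → Type*} [∀ k, Fintype (ι k)]
    {z : (Σ k, ι k) → E} (hz : ∀ k, 1 ≤ ∑ i, ‖z ⟨k, i⟩‖) (σ : ℕ ≃ Σ k, ι k) :
    ¬ Summable fun j => ‖z (σ j)‖ := by
  intro h
  have h_sigma : Summable fun q => ‖z q‖ := σ.summable_iff.1 h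
  have h_sums : Summable fun k => ∑ i, ‖z ⟨k, i⟩‖ := by
    simpa only [tsum_fintype] using h_sigma.sigma
  obtain ⟨k, hk⟩ := (h_sums.tendsto_atTop_zero.eventually_lt_const zero_lt_one).exists
  exact (hz k).not_gt hk

theorem exists_unconditionallySummable_not_summable_norm (hE : ¬ FiniteDimensional 𝕜 E) :
    ∃ x : ℕ → E, UnconditionallySummable 𝕜 1 x ∧ ¬ Summable fun j => ‖x j‖ := by
  obtain ⟨ε, hε_pos, hε_sum⟩ := ENNReal.exists_pos_sum_of_countable one_ne_zero ℕ
  choose m z hz_norm hz_weak using fun k =>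
    exists_one_le_sum_norm_and_sum_norm_apply_le hE (NNReal.coe_pos.2 (hε_pos k))
  have (k : ℕ) : Nonempty (Fin (m k)) := by
    by_contra h
    rw [not_nonempty_iff] at h
    exact absurd (hz_norm k) (by simp)
  obtain ⟨σ⟩ := nonempty_equiv_of_countable (α := ℕ) (β := Σ k, Fin (m k))
  let w : (Σ k, Fin (m k)) → E := fun q => z q.1 q.2
  refine ⟨fun j => w (σ j), unconditionallySummable_one_of_blocks hε_sum.ne_top
    (fun k φ hφ => ?_) σ, not_summable_norm_of_blocks hz_norm σ⟩
  have h := ENNReal.ofReal_le_ofReal (hz_weak k φ hφ)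
  simpa only [ENNReal.ofReal_sum_of_nonneg fun _ _ => norm_nonneg _, ofReal_norm,
    ENNReal.ofReal_coe_nnreal] using h

end DvoretzkyRogersTheorem

section SelfMultiple

variable {𝕜 : Type*} [RCLike 𝕜] {E : Type*} [NormedAddCommGroup E] [NormedSpace 𝕜 E]

theorem eq_zero_of_mem_summingSetOne_smul_self (hE : ¬ FiniteDimensional 𝕜 E) {P : E → 𝕜} {a : E}
    (hP : a ∈ summingSetOne 𝕜 P) (ha : a ∈ summingSetOne 𝕜 fun x => P x • x) : P a = 0 := by
  by_contra hPa
  obtain ⟨x, hx, hx_norm⟩ := exists_unconditionallySummable_not_summable_norm hE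
  obtain ⟨M, hM⟩ := (hx.tendsto_zero.const_add a).norm.bddAbove_range
  have h_bound : Summable fun j =>
      ‖P (a + x j) • (a + x j) - P a • a‖ + ‖P (a + x j) - P a‖ * M :=
    (mem_summingSetOne_iff.1 ha x hx).add ((mem_summingSetOne_iff.1 hP x hx).mul_right M)
  have h_smul : Summable fun j => ‖P a‖ * ‖x j‖ := by
    refine h_bound.of_nonneg_of_le (fun j => by positivity) fun j => ?_
    have h_split : P a • x j =
        (P (a + x j) • (a + x j) - P a • a) - (P (a + x j) - P a) • (a + x j) := by module
    rw [← norm_smul, h_split]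
    refine (norm_sub_le _ _).trans (add_le_add_right ?_ _)
    rw [norm_smul]
    gcongr
    exact hM ⟨j, rfl⟩
  exact hx_norm ((summable_mul_left_iff (norm_ne_zero_iff.2 hPa)).1 h_smul)

theorem IsHomogeneousPolynomial.summingSetOne_smul_self (hE : ¬ FiniteDimensional 𝕜 E) {n : ℕ}
    {P : E → 𝕜} (hP : IsHomogeneousPolynomial 𝕜 n P) :
    summingSetOne 𝕜 (fun x => P x • x) = {x | P x = 0} :=
  Set.Subset.antisymm
    (fun a ha => eq_zero_of_mem_summingSetOne_smul_self hE (hP.mem_summingSetOne a) ha)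
    fun a ha => smul_mem_summingSetOne_of_eq_zero (hP.mem_summingSetOne a) continuousAt_id ha

end SelfMultiple

end SummingSets

theorem mainTheorem9_general :
    (∀ (E : Type*) [NormedAddCommGroup E] [NormedSpace ℂ E]
       (F : Type*) [NormedAddCommGroup F] [NormedSpace ℂ F],
       ¬ FiniteDimensional ℂ E →
       ∀ n : ℕ, 1 ≤ n →
       ∀ P : E → ℂ, SummingSets.IsHomogeneousPolynomial ℂ n P →
       ∀ g : E → F, Continuous g →
         SummingSets.Spaceable ℂ (SummingSets.summingSetOne ℂ (fun x => P x • g x))) ∧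
    (∀ (E : Type*) [NormedAddCommGroup E] [NormedSpace ℝ E],
       ¬ FiniteDimensional ℝ E →
       (∃ P : E → E, SummingSets.IsHomogeneousPolynomial ℝ 3 P ∧
          SummingSets.summingSetOne ℝ P = {0}) ∨
       (∀ (F : Type*) [NormedAddCommGroup F] [NormedSpace ℝ F],
        ∀ P : E → ℝ, SummingSets.IsHomogeneousPolynomial ℝ 2 P →
        ∀ g : E → F, Continuous g →
          SummingSets.Spaceable ℝ (SummingSets.summingSetOne ℝ (fun x => P x • g x)))) := by
  refine ⟨fun E _ _ F _ _ hE n hn P hP g hg => ?_, fun E _ _ hE => ?_⟩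
  · have : NeZero n := ⟨by omega⟩
    obtain ⟨W, -, hW, hPW⟩ := hP.hereditarilyVanishing ⊤
      fun _ => hE (Module.Finite.equiv Submodule.topEquiv)
    exact hP.spaceable_summingSetOne_smul hg hW hPW
  · by_cases hQ : SummingSets.AdmitsPosDefForm E
    · obtain ⟨Q, hQ⟩ := hQ
      have hQ_poly := SummingSets.isHomogeneousPolynomial_two_apply_self Q
      refine Or.inl ⟨fun x => Q x x • x, hQ_poly.smul_self, ?_⟩
      rw [hQ_poly.summingSetOne_smul_self hE]
      exact Set.Subset.antisymm (fun x hx => by_contra fun hx_ne => (hQ x hx_ne).ne' hx) (by simp)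
    · refine Or.inr fun F _ _ P hP g hg => ?_
      obtain ⟨B, hB⟩ := hP.exists_bilinear
      obtain ⟨W, hW, hBW⟩ :=
        SummingSets.exists_infinite_isotropic_of_not_admitsPosDefForm hQ B
      exact hP.spaceable_summingSetOne_smul hg hW fun w hw => (hB w).trans (hBW w hw)

theorem mainTheorem9 :
    -- complex case
    (∀ (E : Type*) [NormedAddCommGroup E] [NormedSpace ℂ E] [CompleteSpace E]
       (F : Type*) [NormedAddCommGroup F] [NormedSpace ℂ F] [CompleteSpace F],
       ¬ FiniteDimensional ℂ E →
       ∀ n : ℕ, 1 ≤ n →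
       ∀ P : E → ℂ, SummingSets.IsHomogeneousPolynomial ℂ n P →
       ∀ g : E → F, Continuous g →
         SummingSets.Spaceable ℂ (SummingSets.summingSetOne ℂ (fun x => P x • g x))) ∧
    -- real case
    (∀ (E : Type*) [NormedAddCommGroup E] [NormedSpace ℝ E] [CompleteSpace E]
       (F : Type*) [NormedAddCommGroup F] [NormedSpace ℝ F] [CompleteSpace F],
       ¬ FiniteDimensional ℝ E →
       (∃ P : E → E, SummingSets.IsHomogeneousPolynomial ℝ 3 P ∧
          SummingSets.summingSetOne ℝ P = {0}) ∨
       (∀ P : E → ℝ, SummingSets.IsHomogeneousPolynomial ℝ 2 P →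
        ∀ g : E → F, Continuous g →
          SummingSets.Spaceable ℝ (SummingSets.summingSetOne ℝ (fun x => P x • g x)))) := by
  obtain ⟨h_complex, h_real⟩ := mainTheorem9_general
  exact ⟨fun E _ _ _ F _ _ _ => h_complex E F,
    fun E _ _ _ F _ _ _ hE => (h_real E hE).imp id fun h => h F⟩
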